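/- All graphs are finite and simple, and $G$ is a graph with at least one vertex. A \emph{tree decomposition} of $G$ is a tree $T$ together with bags $B_x\subseteq V(G)$, one for each node $x$ of $T$, such that for every $v\in V(G)$ the set $\{x\in V(T): v\in B_x\}$ induces a non-empty subtree of $T$, and for every edge $vw$ of $G$ some bag contains both $v$ and $w$. Its \emph{width} is $\max_x |B_x|-1$, and the \emph{treewidth} $\mathrm{tw}(G)$ is the minimum width over all tree decompositions of $G$. For an integer $k\ge 0$, a vertex is \emph{$k$-simplicial} if it has degree $k$ and its neighbours induce a clique; a graph $H$ is a \emph{$k$-tree} if either $H=K_{k+1}$, or $H$ has a $k$-simplicial vertex $v$ and $H-v$ is a $k$-tree. A graph is \emph{chordal} if it contains no induced cycle of length at least four. Lemma. Both minima below, over integers $k\ge 0$, are attained, and \begin{align*} \mathrm{tw}(G) &= \min\{k : G \text{ is a spanning subgraph of a } k\text{-tree}\}\\ &= \min\{k : G \text{ is a spanning subgraph of a chordal graph with no } (k+2)\text{-clique}\}. \end{align*} -/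

import Mathlib

universe u

namespace SimpleGraph

/-- A tree decomposition of `G`: a finite tree whose nodes `x` carry bags `bag x` of vertices
of `G`, such that the nodes whose bags contain a given vertex induce a nonempty subtree
(a tree in Mathlib is connected, hence nonempty), and each edge of `G` lies in some bag.
As the tree is finite, taking its node set in `Type` loses no generality. -/
structure TreeDecomposition {V : Type u} (G : SimpleGraph V) where
  node : Type
  [fintypeNode : Fintype node]
  tree : SimpleGraph node
  isTree : tree.IsTree
  bag : node → Finset V
  subtree : ∀ v : V, (tree.induce {x | v ∈ bag x}).IsTree
  edge_mem : ∀ v w : V, G.Adj v w → ∃ x, v ∈ bag x ∧ w ∈ bag x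

attribute [instance] TreeDecomposition.fintypeNode

/-- The size of the largest bag minus one. If `V` is nonempty then some bag is nonempty,
so the subtraction does not truncate. -/
def TreeDecomposition.width {V : Type u} {G : SimpleGraph V} (D : G.TreeDecomposition) : ℕ :=
  (Finset.univ.sup fun x => (D.bag x).card) - 1

/-- The minimum width of a tree decomposition of `G`. -/
noncomputable def treewidth {V : Type u} (G : SimpleGraph V) : ℕ :=
  sInf (Set.range fun D : G.TreeDecomposition => D.width)

/-- A finite graph has a tree decomposition (with a single bag), so that the minimum defining
`treewidth` is over a nonempty set. -/
theorem nonempty_treeDecomposition {V : Type u} [Finite V] (G : SimpleGraph V) :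
    Nonempty G.TreeDecomposition := by
  classical
  have := Fintype.ofFinite V
  refine ⟨⟨Unit, ⊥, .of_subsingleton, fun _ => Finset.univ, fun v => ?_, fun v w _ =>
    ⟨(), Finset.mem_univ v, Finset.mem_univ w⟩⟩⟩
  have : Nonempty {x : Unit | v ∈ (Finset.univ : Finset V)} := ⟨⟨(), Finset.mem_univ v⟩⟩
  exact .of_subsingleton

/-- The minimum in the definition of `treewidth` is attained. -/
theorem isLeast_treewidth {V : Type u} [Finite V] (G : SimpleGraph V) :
    IsLeast (Set.range fun D : G.TreeDecomposition => D.width) G.treewidth :=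
  have := G.nonempty_treeDecomposition
  ⟨Nat.sInf_mem (Set.range_nonempty _), fun _ h => Nat.sInf_le h⟩

/-- A vertex is `k`-simplicial if it has degree `k` and its neighbours form a clique. -/
def IsSimplicialVertex {V : Type u} (G : SimpleGraph V) (k : ℕ) (v : V) : Prop :=
  (G.neighborSet v).encard = k ∧ G.IsClique (G.neighborSet v)

/-- A `k`-tree is either a complete graph on `k + 1` vertices, or a graph with a `k`-simplicial
vertex whose deletion leaves a `k`-tree. -/
inductive IsKTree (k : ℕ) : {V : Type u} → SimpleGraph V → Prop
  | complete {V : Type u} (hcard : Nat.card V = k + 1) : IsKTree k (⊤ : SimpleGraph V)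
  | addVertex {V : Type u} (G : SimpleGraph V) (v : V) (hv : G.IsSimplicialVertex k v)
      (hG : IsKTree k (G.induce {v}ᶜ)) : IsKTree k G

/-- A graph is chordal if it has no induced cycle of length at least four. -/
def IsChordal {V : Type u} (G : SimpleGraph V) : Prop :=
  ∀ n : ℕ, 4 ≤ n → ¬ (cycleGraph n).IsIndContained G

end SimpleGraph

namespace SimpleGraph

/-! A `k`-tree is chordal and has no `(k+2)`-clique, so the second set of integers contains the
first. It remains to show that the treewidth lies in the first set and is a lower bound for the
second.

Lower bound: by Dirac's theorem a chordal graph `H` has a simplicial vertex `v`. Given a tree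
decomposition of `H - v`, some bag contains the clique of neighbours of `v`; attaching to it a leaf
whose bag is the closed neighbourhood of `v` yields by induction a decomposition of `H` into
cliques. It also decomposes every spanning subgraph (`IsChordal.exists_treeDecomposition`,
`IsChordal.treewidth_le`).

Membership (`TreeDecomposition.exists_isKTree_ge`): a leaf bag of a decomposition is either
redundant or has a private vertex `v`. In the latter case, the rest of the bag is made a clique and
`v` deleted; in the `k`-tree obtained by induction that clique extends to a `k`-clique, to which `v`
is joined. -/

/-! ### Chordality and cliques of `k`-trees. -/

/-- Long cycles have no simplicial vertex, so an induced one in `G` avoids every simplicial vertex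
of `G`. -/
theorem cycleGraph_exists_adj_adj_not_adj {n : ℕ} (hn : 4 ≤ n) (i : Fin n) :
    ∃ a b, (cycleGraph n).Adj i a ∧ (cycleGraph n).Adj i b ∧ a ≠ b ∧ ¬ (cycleGraph n).Adj a b := by
  obtain ⟨m, rfl⟩ := Nat.exists_eq_add_of_le' hn
  have h2 : (1 + 1 : Fin (m + 4)) ≠ 0 := by
    simp [Fin.ext_iff, Fin.val_add, Nat.mod_eq_of_lt (show 2 < m + 4 by omega)]
  have h1 : (1 + 1 : Fin (m + 4)) ≠ 1 := by simp
  have h3 : (1 + 1 + 1 : Fin (m + 4)) ≠ 0 := by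
    simp [Fin.ext_iff, Fin.val_add, Nat.mod_eq_of_lt (show 3 < m + 4 by omega)]
  refine ⟨i + 1, i - 1, ?_, ?_, ?_, ?_⟩
  · simp [cycleGraph_adj]
  · simp [cycleGraph_adj]
  · intro h
    apply h2
    rw [← sub_eq_zero] at h
    rw [← h]; abel
  · rw [cycleGraph_adj]
    rintro (h | h)
    · apply h1
      calc (1 + 1 : Fin (m + 4)) = i + 1 - (i - 1) := by abel
        _ = 1 := h
    · apply h3
      rw [← sub_eq_zero] at h
      rw [← neg_eq_zero, ← h]; abel

theorem IsChordal.induce {V : Type u} {G : SimpleGraph V} (hG : G.IsChordal) (s : Set V) :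
    (G.induce s).IsChordal :=
  fun n hn ⟨f⟩ => hG n hn ⟨(Embedding.induce s).comp f⟩

/-- Adding a vertex whose neighbours form a clique preserves chordality. -/
theorem IsChordal.of_induce_compl_singleton {V : Type u} {G : SimpleGraph V} {v : V}
    (hv : G.IsClique (G.neighborSet v)) (hG : (G.induce {v}ᶜ).IsChordal) : G.IsChordal := by
  rintro n hn ⟨f⟩
  by_cases h : ∃ i, f i = v
  · obtain ⟨i, rfl⟩ := h
    obtain ⟨a, b, ha, hb, hab, hnab⟩ := cycleGraph_exists_adj_adj_not_adj hn i
    exact hnab (f.map_adj_iff.1 (hv (f.map_adj_iff.2 ha) (f.map_adj_iff.2 hb)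
      (f.injective.ne hab)))
  · push Not at h
    exact hG n hn ⟨⟨⟨fun i => ⟨f i, h i⟩, fun i j hij => f.injective (congrArg Subtype.val hij)⟩,
      f.map_adj_iff⟩⟩

theorem isChordal_top {V : Type u} : (⊤ : SimpleGraph V).IsChordal := by
  rintro n hn ⟨f⟩
  obtain ⟨a, b, -, -, hab, hnab⟩ := cycleGraph_exists_adj_adj_not_adj hn ⟨0, by omega⟩
  exact hnab (f.map_adj_iff.1 (f.injective.ne hab))

theorem IsKTree.isChordal {k : ℕ} {V : Type u} {G : SimpleGraph V} (hG : G.IsKTree k) :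
    G.IsChordal := by
  induction hG with
  | complete => exact isChordal_top
  | addVertex G v hv _ ih => exact ih.of_induce_compl_singleton hv.2

theorem IsClique.preimage_val {V : Type u} {G : SimpleGraph V} {s t : Set V} (ht : G.IsClique t) :
    (G.induce s).IsClique (Subtype.val ⁻¹' t) :=
  fun _ ha _ hb hab => ht ha hb (Subtype.val_injective.ne hab)

theorem subset_insert_neighborSet_of_isClique {V : Type u} {G : SimpleGraph V} {s : Set V} {v : V}
    (hs : G.IsClique s) (hv : v ∈ s) : s ⊆ insert v (G.neighborSet v) := by
  intro a ha
  by_cases h : a = v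
  · exact .inl h
  · exact .inr (hs hv ha (Ne.symm h))

theorem encard_insert_neighborSet {V : Type u} {G : SimpleGraph V} {k : ℕ} {v : V}
    (hv : G.IsSimplicialVertex k v) : (insert v (G.neighborSet v)).encard = k + 1 := by
  rw [Set.encard_insert_of_notMem (by simp), hv.1]

/-- Every clique of a `k`-tree extends to a clique on `k + 1` vertices. -/
theorem IsKTree.exists_isClique_superset {k : ℕ} {V : Type u} {G : SimpleGraph V}
    (hG : G.IsKTree k) {s : Set V} (hs : G.IsClique s) :
    ∃ t, s ⊆ t ∧ G.IsClique t ∧ t.encard = k + 1 := by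
  induction hG with
  | @complete V hcard =>
    refine ⟨Set.univ, Set.subset_univ _, .top _, ?_⟩
    have : Finite V := Nat.finite_of_card_ne_zero (by omega)
    rw [Set.encard_univ, ENat.card_eq_coe_natCard, hcard]
    rfl
  | addVertex G v hv _ ih =>
    -- A clique through `v` lies in the closed neighbourhood of `v`, itself a clique on `k + 1`
    -- vertices.
    by_cases hvs : v ∈ s
    · exact ⟨_, subset_insert_neighborSet_of_isClique hs hvs, hv.2.insert fun b hb _ => hb,
        encard_insert_neighborSet hv⟩
    · obtain ⟨t, hst, ht, hcard⟩ := ih hs.preimage_val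
      refine ⟨Subtype.val '' t, fun a ha => ?_, ?_, ?_⟩
      · exact ⟨⟨a, fun h => hvs (h ▸ ha)⟩, hst ha, rfl⟩
      · rintro _ ⟨a, ha, rfl⟩ _ ⟨b, hb, rfl⟩ hab
        exact ht ha hb fun h => hab (congrArg Subtype.val h)
      · rw [Subtype.val_injective.encard_image, hcard]

theorem IsKTree.cliqueFree {k : ℕ} {V : Type u} {G : SimpleGraph V} (hG : G.IsKTree k) :
    G.CliqueFree (k + 2) := by
  intro s hs
  obtain ⟨t, hst, -, ht⟩ := hG.exists_isClique_superset hs.isClique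
  have h := Set.encard_le_encard hst
  rw [Set.encard_coe_eq_coe_finsetCard, hs.card_eq, ht] at h
  norm_cast at h
  omega

/-! ### Dirac's theorem on simplicial vertices. -/

theorem cycleGraph_adj_iff_of_lt {n : ℕ} {i j : Fin n} (hij : i < j) :
    (cycleGraph n).Adj i j ↔ j.val = i.val + 1 ∨ (i.val = 0 ∧ j.val + 1 = n) := by
  have hj := j.isLt
  rw [Fin.lt_def] at hij
  rw [cycleGraph_adj', Fin.sub_val_of_le (show i ≤ j from hij.le), Fin.coe_sub_iff_lt.2 hij]
  omega

/-- Otherwise the edge would be a shortcut in a shortest walk. -/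
theorem Walk.le_add_one_of_adj_getVert {V : Type u} {G : SimpleGraph V} {a b : V}
    (p : G.Walk a b) (hp : p.length = G.dist a b) {i j : ℕ} (hj : j ≤ p.length)
    (h : G.Adj (p.getVert i) (p.getVert j)) : j ≤ i + 1 := by
  have := G.dist_le ((p.take i).append (.cons h (p.drop j)))
  simp only [Walk.length_append, Walk.length_cons, Walk.take_length, Walk.drop_length] at this
  omega

/-- In a chordal graph, if two neighbours of `u` are joined by a path with no further vertex
in the closed neighbourhood of `u`, then they are adjacent. -/
theorem IsChordal.adj_of_reachable_induce {V : Type u} {G : SimpleGraph V} (hG : G.IsChordal)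
    {s : Set V} {a b : s} (hab : (G.induce s).Reachable a b) (hne : a ≠ b) {u : V} (hu : u ∉ s)
    (hua : G.Adj u a) (hub : G.Adj u b) (hs : ∀ x : s, G.Adj u x → x = a ∨ x = b) :
    G.Adj a b := by
  by_contra hnadj
  obtain ⟨p, hp⟩ := hab.exists_walk_length_eq_dist
  have hlen : 1 < p.length := hp ▸ hab.one_lt_dist_of_ne_of_not_adj hne hnadj
  have hinj := (p.isPath_of_length_eq_dist hp).getVert_injOn
  have hpath : ∀ i j, i < j → j ≤ p.length →
      (G.Adj (p.getVert i) (p.getVert j) ↔ j = i + 1) := by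
    intro i j hij hj
    constructor
    · intro h
      have := p.le_add_one_of_adj_getVert hp hj h
      omega
    · rintro rfl
      exact p.adj_getVert_succ hj
  have hapex : ∀ i ≤ p.length, (G.Adj u (p.getVert i) ↔ i = 0 ∨ i = p.length) := by
    intro i hi
    constructor
    · intro h
      refine (hs _ h).imp (fun h => ?_) (fun h => ?_)
      · exact hinj hi (Nat.zero_le _) (by simpa using h)
      · exact hinj hi (le_refl p.length) (by simpa using h)
    · rintro (rfl | rfl) <;> simpa
  -- A shortest path from `a` to `b`, closed up by `u` at the last index, is an induced cycle; its
  -- length is at least 4 since `a` and `b` are not adjacent.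
  let f : Fin (p.length + 2) → V := fun i => if i.val ≤ p.length then p.getVert i else u
  have hf : ∀ i j, i < j → (f i ≠ f j ∧ (G.Adj (f i) (f j) ↔ (cycleGraph _).Adj i j)) := by
    intro i j hij
    rw [cycleGraph_adj_iff_of_lt hij]
    have hj := j.isLt
    rw [Fin.lt_def] at hij
    have hi : i.val ≤ p.length := by omega
    simp only [f, if_pos hi]
    split_ifs with h
    · refine ⟨fun h' => hij.ne (hinj hi h (Subtype.ext h')), ?_⟩
      rw [hpath _ _ hij h]
      omega
    · refine ⟨fun h' => hu (h' ▸ (p.getVert i).2), ?_⟩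
      rw [G.adj_comm, hapex _ hi]
      omega
  refine hG (p.length + 2) (by omega) ⟨⟨⟨f, fun i j h => ?_⟩, fun {i j} => ?_⟩⟩
  · rcases lt_trichotomy i j with h' | h' | h'
    · exact absurd h (hf i j h').1
    · exact h'
    · exact absurd h.symm (hf j i h').1
  · rcases lt_trichotomy i j with h' | rfl | h'
    · exact (hf i j h').2
    · simp
    · rw [G.adj_comm, (cycleGraph _).adj_comm]
      exact (hf j i h').2

/-- Relative to a set `A` of vertices of a chordal graph, each vertex of `A` that is not adjacent
to all others has a non-neighbour whose neighbours in `A` form a clique. -/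
theorem IsChordal.exists_not_adj_isClique_neighborSet_inter {V : Type u} [Finite V]
    {G : SimpleGraph V} (hG : G.IsChordal) (A : Set V) {u w : V} (hu : u ∈ A) (hw : w ∈ A)
    (hwu : w ≠ u) (huw : ¬ G.Adj u w) :
    ∃ t ∈ A, t ≠ u ∧ ¬ G.Adj u t ∧ G.IsClique (G.neighborSet t ∩ A) := by
  induction hn : A.ncard using Nat.strong_induction_on generalizing A u w with
  | _ n ih =>
  subst hn
  -- `C` is the component of `w` among the non-neighbours of `u` in `A`, and `S` is its attachment
  -- set among the neighbours of `u`.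
  set B : Set V := {x | x ∈ A ∧ x ≠ u ∧ ¬ G.Adj u x} with hB
  have hwB : w ∈ B := ⟨hw, hwu, huw⟩
  set C : Set V := {x | ∃ h : x ∈ B, (G.induce B).Reachable ⟨w, hwB⟩ ⟨x, h⟩} with hC
  set S : Set V := {x | x ∈ A ∧ G.Adj u x ∧ ∃ c ∈ C, G.Adj x c} with hS
  have hCB : C ⊆ B := fun x hx => hx.1
  have hwC : w ∈ C := ⟨hwB, .rfl⟩
  have hclosed : ∀ x ∈ C, G.neighborSet x ∩ A ⊆ C ∪ S := by
    rintro x hx y ⟨hxy, hyA⟩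
    rw [mem_neighborSet] at hxy
    by_cases huy : G.Adj u y
    · exact .inr ⟨hyA, huy, x, hx, hxy.symm⟩
    · have hyB : y ∈ B := ⟨hyA, by rintro rfl; exact (hCB hx).2.2 hxy.symm, huy⟩
      have hadj : (G.induce B).Adj ⟨x, hx.1⟩ ⟨y, hyB⟩ := hxy
      exact .inl ⟨hyB, hx.2.trans hadj.reachable⟩
  -- Two vertices of `S` are connected through `C`, and inside `B ∪ {a, b}` only they are adjacent
  -- to `u`.
  have hSclique : G.IsClique S := by
    rintro a ⟨-, hua, c, hc, hac⟩ b ⟨-, hub, d, hd, hbd⟩ hab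
    have hle : B ≤ B ∪ {a, b} := Set.subset_union_left
    have hcd : (G.induce (B ∪ {a, b})).Reachable ⟨c, hle hc.1⟩ ⟨d, hle hd.1⟩ :=
      (hc.2.symm.trans hd.2).map (induceHomOfLE G hle).toHom
    have hac' : (G.induce (B ∪ {a, b})).Adj ⟨a, by simp⟩ ⟨c, hle hc.1⟩ := hac
    have hdb' : (G.induce (B ∪ {a, b})).Adj ⟨d, hle hd.1⟩ ⟨b, by simp⟩ := hbd.symm
    refine hG.adj_of_reachable_induce (hac'.reachable.trans (hcd.trans hdb'.reachable))
      (fun h => hab (congrArg Subtype.val h)) (u := u) ?_ hua hub ?_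
    · rintro (h | rfl | h)
      · exact h.2.1 rfl
      · exact hua.ne rfl
      · exact hub.ne h
    · rintro ⟨x, h | h | h⟩ hux
      · exact absurd hux h.2.2
      · exact .inl (Subtype.ext h)
      · exact .inr (Subtype.ext h)
  have hDA : C ∪ S ⊆ A := Set.union_subset (fun x hx => (hCB hx).1) fun x hx => hx.1
  have huD : u ∉ C ∪ S := by
    rintro (h | h)
    · exact (hCB h).2.1 rfl
    · exact h.2.1.ne rfl
  have hlt : ∀ D ⊆ C ∪ S, D.ncard < A.ncard := fun D hD =>
    Set.ncard_lt_ncard ((hD.trans hDA).ssubset_of_mem_notMem hu fun h => huD (hD h))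
  suffices ∃ t ∈ C, G.IsClique (G.neighborSet t ∩ (C ∪ S)) by
    obtain ⟨t, htC, ht⟩ := this
    have hsub : G.neighborSet t ∩ A ⊆ G.neighborSet t ∩ (C ∪ S) := fun x hx =>
      ⟨hx.1, hclosed t htC hx⟩
    exact ⟨t, (hCB htC).1, (hCB htC).2.1, (hCB htC).2.2, ht.subset hsub⟩
  -- If some `s` in `S` misses a vertex of `C ∪ S`, induction with `s` in place of `u` gives a
  -- vertex outside the clique `S`, hence in `C`. Otherwise `S` is joined to everything, and a
  -- vertex simplicial within `C` suffices.
  by_cases h : ∃ s ∈ S, ∃ x ∈ C ∪ S, x ≠ s ∧ ¬ G.Adj s x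
  · obtain ⟨s, hs, x, hx, hxs, hsx⟩ := h
    obtain ⟨t, ht, hts, hst, htc⟩ := ih _ (hlt _ subset_rfl) (C ∪ S) (.inr hs) hx hxs hsx rfl
    exact ⟨t, ht.resolve_right fun h => hst (hSclique hs h hts.symm), htc⟩
  · push Not at h
    obtain ⟨t, ht, htc⟩ : ∃ t ∈ C, G.IsClique (G.neighborSet t ∩ C) := by
      by_cases hcl : G.IsClique C
      · exact ⟨w, hwC, hcl.subset Set.inter_subset_right⟩
      · simp only [IsClique, Set.Pairwise] at hcl
        push Not at hcl
        obtain ⟨x, hx, y, hy, hxy, hnadj⟩ := hcl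
        obtain ⟨t, ht, -, -, htc⟩ := ih _ (hlt _ Set.subset_union_left) C hx hy hxy.symm hnadj rfl
        exact ⟨t, ht, htc⟩
    refine ⟨t, ht, ?_⟩
    rintro a ⟨hta, ha⟩ b ⟨htb, hb⟩ hab
    rcases ha with haC | haS
    · rcases hb with hbC | hbS
      · exact htc ⟨hta, haC⟩ ⟨htb, hbC⟩ hab
      · exact (h b hbS a (.inl haC) hab).symm
    · exact h a haS b hb hab.symm

/-- Dirac's theorem: a nonempty finite chordal graph has a simplicial vertex. -/
theorem IsChordal.exists_isClique_neighborSet {V : Type u} [Finite V] [Nonempty V]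
    {G : SimpleGraph V} (hG : G.IsChordal) : ∃ v, G.IsClique (G.neighborSet v) := by
  by_cases h : ∃ u w, w ≠ u ∧ ¬ G.Adj u w
  · obtain ⟨u, w, hwu, huw⟩ := h
    obtain ⟨t, -, -, -, ht⟩ := hG.exists_not_adj_isClique_neighborSet_inter Set.univ
      (Set.mem_univ u) (Set.mem_univ w) hwu huw
    exact ⟨t, by simpa using ht⟩
  · push Not at h
    exact ⟨Classical.arbitrary V, fun a _ b _ hab => h a b hab.symm⟩

/-! ### Adding and deleting leaves of trees. -/

/-- The graph obtained from `T` by attaching a new leaf `none` to the vertex `x`. -/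
def addLeaf {α : Type*} (T : SimpleGraph α) (x : α) : SimpleGraph (Option α) where
  Adj
    | some a, some b => T.Adj a b
    | none, some b => b = x
    | some a, none => a = x
    | none, none => False
  symm := ⟨by rintro (_ | a) (_ | b) h; exacts [h, h, h, h.symm]⟩
  loopless := ⟨by rintro (_ | a) h; exacts [h, T.irrefl h]⟩

/-- A cycle through `none` would need two distinct neighbours of it, but `x` is the only one. -/
theorem IsAcyclic.addLeaf {α : Type*} {T : SimpleGraph α} (hT : T.IsAcyclic) (x : α) :
    (T.addLeaf x).IsAcyclic := by
  rw [isAcyclic_iff_free_cycleGraph] at hT ⊢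
  rintro n hn ⟨f⟩
  by_cases h : ∃ i, f i = none
  · obtain ⟨i, hi⟩ := h
    obtain ⟨m, rfl⟩ := Nat.exists_eq_add_of_le' hn
    have key : ∀ j, (cycleGraph (m + 3)).Adj i j → f j = some x := by
      intro j hj
      have := f.toHom.map_adj hj
      change (T.addLeaf x).Adj (f i) (f j) at this
      rw [hi] at this
      cases hfj : f j with
      | none => rw [hfj] at this; exact this.elim
      | some b => rw [hfj] at this; exact congrArg some this
    have h2 : (1 + 1 : Fin (m + 3)) ≠ 0 := by
      simp [Fin.ext_iff, Fin.val_add, Nat.mod_eq_of_lt (show 2 < m + 3 by omega)]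
    have heq : i + 1 = i - 1 := f.injective
      ((key _ (by simp [cycleGraph_adj])).trans (key _ (by simp [cycleGraph_adj])).symm)
    apply h2
    rw [← sub_eq_zero] at heq
    rw [← heq]; abel
  · push Not at h
    choose g hg using fun i => Option.ne_none_iff_exists'.1 (h i)
    refine hT n hn ⟨⟨⟨g, fun {i j} hij => ?_⟩, fun i j hij => f.injective ?_⟩⟩
    · have := f.toHom.map_adj hij
      change (T.addLeaf x).Adj (f i) (f j) at this
      rwa [hg, hg] at this
    · change g i = g j at hij
      change f i = f j
      rw [hg, hg, hij]

/-- A map sending adjacent vertices to equal or adjacent vertices preserves reachability. -/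
theorem Reachable.map_of_adj_or_eq {α β : Type*} {G : SimpleGraph α} {H : SimpleGraph β}
    (f : α → β) (hf : ∀ a b, G.Adj a b → f a = f b ∨ H.Adj (f a) (f b)) {a b : α}
    (h : G.Reachable a b) : H.Reachable (f a) (f b) := by
  obtain ⟨p⟩ := h
  induction p with
  | nil => exact .rfl
  | cons hadj _ ih =>
    rcases hf _ _ hadj with h | h
    · exact h ▸ ih
    · exact h.reachable.trans ih

theorem connected_induce_addLeaf {α : Type*} {T : SimpleGraph α} {x : α} {S : Set (Option α)}
    (hS : (T.induce (some ⁻¹' S)).Connected) (hx : none ∈ S → some x ∈ S) :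
    ((T.addLeaf x).induce S).Connected := by
  obtain ⟨⟨b, hb⟩⟩ := hS.nonempty
  have key : ∀ a (ha : some a ∈ S),
      ((T.addLeaf x).induce S).Reachable ⟨some b, hb⟩ ⟨some a, ha⟩ := fun a ha =>
    (hS.preconnected ⟨b, hb⟩ ⟨a, ha⟩).map_of_adj_or_eq
      (f := fun z => (⟨some z.1, z.2⟩ : S)) (fun _ _ h => .inr h)
  rw [connected_iff_exists_forall_reachable]
  refine ⟨⟨some b, hb⟩, ?_⟩
  rintro ⟨_ | a, ha⟩
  · have hadj : ((T.addLeaf x).induce S).Adj ⟨some x, hx ha⟩ ⟨none, ha⟩ :=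
      show x = x from rfl
    exact (key x (hx ha)).trans hadj.reachable
  · exact key a ha

theorem IsTree.addLeaf {α : Type*} {T : SimpleGraph α} (hT : T.IsTree) (x : α) :
    (T.addLeaf x).IsTree := by
  refine ⟨?_, hT.isAcyclic.addLeaf x⟩
  rw [← (induceUnivIso _).connected_iff]
  refine connected_induce_addLeaf ?_ fun _ => trivial
  rw [Set.preimage_univ, (induceUnivIso _).connected_iff]
  exact hT.connected

/-- Deleting a leaf `x` with neighbour `y` from a subtree that contains `y` if it contains `x`. -/
theorem connected_induce_induce_compl_leaf {α : Type*} {T : SimpleGraph α} {x y : α}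
    (hxy : T.Adj x y) (hleaf : ∀ z, T.Adj x z → z = y) {S : Set α} (hS : (T.induce S).Connected)
    (hy : x ∈ S → y ∈ S) :
    ((T.induce {x}ᶜ).induce {z | z.1 ∈ S}).Connected := by
  classical
  have hyx : y ≠ x := hxy.ne'
  -- Contracting the leaf `x` onto `y` carries walks to walks.
  let f : S → {z : ({x}ᶜ : Set α) | z.1 ∈ S} := fun z =>
    if h : z.1 = x then ⟨⟨y, hyx⟩, hy (h ▸ z.2)⟩ else ⟨⟨z.1, h⟩, z.2⟩
  have hf : ∀ a b, (T.induce S).Adj a b →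
      f a = f b ∨ ((T.induce {x}ᶜ).induce {z | z.1 ∈ S}).Adj (f a) (f b) := by
    rintro ⟨a, ha⟩ ⟨b, hb⟩ (hab : T.Adj a b)
    by_cases hax : a = x
    · subst hax
      obtain rfl := hleaf b hab
      exact .inl (by simp [f, hyx])
    · by_cases hbx : b = x
      · subst hbx
        obtain rfl := hleaf a hab.symm
        exact .inl (by simp [f, hyx])
      · exact .inr (by simpa [f, hax, hbx] using hab)
  have hsurj : ∀ z, ∃ w, f w = z := fun ⟨⟨z, hz⟩, hzS⟩ =>
    ⟨⟨z, hzS⟩, dif_neg hz⟩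
  rw [connected_iff]
  refine ⟨fun z w => ?_, ⟨f (Classical.choice hS.nonempty)⟩⟩
  obtain ⟨z, rfl⟩ := hsurj z
  obtain ⟨w, rfl⟩ := hsurj w
  exact (hS.preconnected z w).map_of_adj_or_eq f hf

theorem IsTree.induce_compl_leaf {α : Type*} {T : SimpleGraph α} {x y : α} (hT : T.IsTree)
    (hxy : T.Adj x y) (hleaf : ∀ z, T.Adj x z → z = y) : (T.induce {x}ᶜ).IsTree := by
  refine ⟨?_, hT.isAcyclic.induce _⟩
  have h := connected_induce_induce_compl_leaf hxy hleaf (S := Set.univ)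
    ((induceUnivIso T).connected_iff.2 hT.connected) fun _ => trivial
  exact (induceUnivIso _).connected_iff.1 h

/-! ### Clique decompositions of chordal graphs. -/

/-- A finite chordal graph has a tree decomposition whose bags are cliques and such that every
clique is contained in a bag. -/
theorem IsChordal.exists_treeDecomposition {V : Type u} [Finite V] {G : SimpleGraph V}
    (hG : G.IsChordal) : ∃ D : G.TreeDecomposition,
      (∀ s : Set V, G.IsClique s → ∃ x, s ⊆ D.bag x) ∧ ∀ x, G.IsClique (D.bag x : Set V) := by
  classical
  induction hn : Nat.card V using Nat.strong_induction_on generalizing V with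
  | _ n ih =>
  subst hn
  rcases isEmpty_or_nonempty V with hV | hV
  · obtain ⟨D⟩ := G.nonempty_treeDecomposition
    have := D.isTree.connected.nonempty
    exact ⟨D, fun s _ => ⟨Classical.arbitrary _, fun v => hV.elim v⟩, fun _ v => hV.elim v⟩
  obtain ⟨v, hv⟩ := hG.exists_isClique_neighborSet
  have hlt : Nat.card ({v}ᶜ : Set V) < Nat.card V :=
    Finite.card_subtype_lt (x := v) (by simp)
  obtain ⟨D, hD, hDbag⟩ := ih _ hlt (hG.induce {v}ᶜ) rfl
  obtain ⟨x, hx⟩ := hD _ hv.preimage_val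
  have := Fintype.ofFinite V
  let bag : Option D.node → Finset V
    | none => (insert v (G.neighborSet v)).toFinset
    | some z => (D.bag z).map (Function.Embedding.subtype _)
  have hnone : (bag none : Set V) = insert v (G.neighborSet v) := by simp [bag]
  have hsome : ∀ z w (hw : w ≠ v), w ∈ bag (some z) ↔ ⟨w, hw⟩ ∈ D.bag z := by
    intro z w hw
    simp only [bag, Finset.mem_map, Function.Embedding.subtype_apply, Subtype.exists]
    exact ⟨fun ⟨a, ha, h, e⟩ => by subst e; exact h, fun h => ⟨w, hw, h, rfl⟩⟩
  have hvsome : ∀ z, v ∉ bag (some z) := by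
    simp [bag]
  refine ⟨⟨Option D.node, D.tree.addLeaf x, D.isTree.addLeaf x, bag, fun w => ?_, ?_⟩, ?_, ?_⟩
  · by_cases hw : w = v
    · subst hw
      have hset : {z | w ∈ bag z} = {none} := by
        ext (_ | z)
        · simp [bag]
        · simpa using hvsome z
      rw [hset]
      exact .of_subsingleton
    · refine ⟨connected_induce_addLeaf ?_ ?_, (D.isTree.addLeaf x).isAcyclic.induce _⟩
      · have hset : some ⁻¹' {z | w ∈ bag z} = {z | (⟨w, hw⟩ : ({v}ᶜ : Set V)) ∈ D.bag z} := by
          ext z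
          exact hsome z w hw
        rw [hset]
        exact (D.subtree _).connected
      · intro h
        have h' : w ∈ insert v (G.neighborSet v) := hnone ▸ h
        exact (hsome x w hw).2 (hx (h'.resolve_left hw))
  · intro a b hab
    by_cases ha : a = v
    · subst ha
      exact ⟨none, by simp [bag], by simpa [bag] using .inr hab⟩
    · by_cases hb : b = v
      · subst hb
        exact ⟨none, by simpa [bag] using .inr hab.symm, by simp [bag]⟩
      · obtain ⟨z, hza, hzb⟩ := D.edge_mem ⟨a, ha⟩ ⟨b, hb⟩ hab
        exact ⟨some z, (hsome z a ha).2 hza, (hsome z b hb).2 hzb⟩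
  · intro s hs
    by_cases hvs : v ∈ s
    · refine ⟨none, ?_⟩
      change s ⊆ (bag none : Set V)
      exact hnone.symm ▸ subset_insert_neighborSet_of_isClique hs hvs
    · obtain ⟨z, hz⟩ := hD _ hs.preimage_val
      refine ⟨some z, fun a ha => ?_⟩
      have hav : a ≠ v := fun h => hvs (h ▸ ha)
      exact (hsome z a hav).2 (hz (a := ⟨a, hav⟩) ha)
  · rintro (_ | z)
    · rw [hnone]
      exact hv.insert fun b hb _ => hb
    · intro a ha b hb hab
      have hav : a ≠ v := fun h => hvsome z (h ▸ ha)
      have hbv : b ≠ v := fun h => hvsome z (h ▸ hb)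
      exact hDbag z ((hsome z a hav).1 ha) ((hsome z b hbv).1 hb)
        fun h => hab (congrArg Subtype.val h)

theorem IsChordal.treewidth_le {V : Type u} [Finite V] {G H : SimpleGraph V} (hGH : G ≤ H)
    (hH : H.IsChordal) {k : ℕ} (hfree : H.CliqueFree (k + 2)) : G.treewidth ≤ k := by
  obtain ⟨D, -, hD⟩ := hH.exists_treeDecomposition
  let D' : G.TreeDecomposition :=
    ⟨D.node, D.tree, D.isTree, D.bag, D.subtree, fun v w h => D.edge_mem v w (hGH h)⟩
  refine (G.isLeast_treewidth.2 ⟨D', rfl⟩).trans ?_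
  refine Nat.sub_le_of_le_add (Finset.sup_le fun x _ => ?_)
  by_contra! h
  exact hfree.mono (show k + 2 ≤ (D.bag x).card from h) _ ⟨hD x, rfl⟩

/-! ### From tree decompositions to `k`-trees. -/

/-- The graph on `V` obtained from a graph on `V \ {v}` by joining `v` to the vertices in `s`. -/
def addVertexAdj {V : Type u} {v : V} (H : SimpleGraph ({v}ᶜ : Set V)) (s : Set ({v}ᶜ : Set V)) :
    SimpleGraph V :=
  H.map Subtype.val ⊔ fromRel fun a b => a = v ∧ b ∈ Subtype.val '' s

section

variable {V : Type u} {v : V} (H : SimpleGraph ({v}ᶜ : Set V)) (s : Set ({v}ᶜ : Set V))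

theorem addVertexAdj_adj_coe (a b : ({v}ᶜ : Set V)) :
    (addVertexAdj H s).Adj a b ↔ H.Adj a b := by
  have ha : a.1 ≠ v := a.2
  have hb : b.1 ≠ v := b.2
  have h : (H.map Subtype.val).Adj a.1 b ↔ H.Adj a b :=
    map_adj_apply (f := Function.Embedding.subtype _)
  simp [addVertexAdj, h, ha, hb]

theorem addVertexAdj_adj_self (a : ({v}ᶜ : Set V)) :
    (addVertexAdj H s).Adj v a ↔ a ∈ s := by
  have ha : a.1 ≠ v := a.2
  have h : ¬ (H.map Subtype.val).Adj v a := by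
    rintro ⟨-, b, -, -, hb, -⟩
    exact b.2 hb
  simp [addVertexAdj, h, ha, ha.symm]

theorem neighborSet_addVertexAdj : (addVertexAdj H s).neighborSet v = Subtype.val '' s := by
  ext a
  by_cases ha : a = v
  · subst ha
    simp
  · rw [mem_neighborSet, addVertexAdj_adj_self H s ⟨a, ha⟩]
    exact ⟨fun h => ⟨_, h, rfl⟩, fun ⟨b, hb, e⟩ => by subst e; exact hb⟩

theorem IsKTree.addVertexAdj {k : ℕ} {H : SimpleGraph ({v}ᶜ : Set V)} (hH : H.IsKTree k)
    {s : Set ({v}ᶜ : Set V)} (hs : H.IsClique s) (hcard : s.encard = k) :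
    (addVertexAdj H s).IsKTree k := by
  refine .addVertex _ v ⟨?_, ?_⟩ ?_
  · rw [neighborSet_addVertexAdj, Subtype.val_injective.encard_image, hcard]
  · rw [neighborSet_addVertexAdj]
    rintro _ ⟨a, ha, rfl⟩ _ ⟨b, hb, rfl⟩ hab
    exact (addVertexAdj_adj_coe H s a b).2 (hs ha hb fun h => hab (congrArg Subtype.val h))
  · have : (SimpleGraph.addVertexAdj H s).induce {v}ᶜ = H := by
      ext a b
      exact addVertexAdj_adj_coe H s a b
    rwa [this]

end

theorem isKTree_of_card_eq {V : Type u} {k : ℕ} (h : Nat.card V = k + 1) (G : SimpleGraph V) :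
    ∃ H : SimpleGraph V, G ≤ H ∧ H.IsKTree k :=
  ⟨⊤, le_top, .complete h⟩

/-- A vertex that lies in a single bag can be deleted from a tree decomposition, while the rest of
that bag is turned into a clique. -/
theorem TreeDecomposition.exists_deleteVertex {V : Type u} [Finite V] {G : SimpleGraph V}
    (D : G.TreeDecomposition) (v : V) (x : D.node) :
    ∃ D' : (G.induce {v}ᶜ ⊔ fromRel fun a b : ({v}ᶜ : Set V) =>
        a.1 ∈ D.bag x ∧ b.1 ∈ D.bag x).TreeDecomposition,
      Nat.card D'.node = Nat.card D.node ∧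
        ∀ k, (∀ z, (D.bag z).card ≤ k) → ∀ z, (D'.bag z).card ≤ k := by
  classical
  refine ⟨⟨D.node, D.tree, D.isTree, fun z => (D.bag z).subtype _, fun w => ?_, ?_⟩, rfl, ?_⟩
  · have hset : {z | w ∈ (D.bag z).subtype (· ∈ ({v}ᶜ : Set V))} = {z | w.1 ∈ D.bag z} := by
      ext z
      exact Finset.mem_subtype
    rw [hset]
    exact D.subtree w
  · rintro a b (h | ⟨-, h | h⟩)
    · simpa using D.edge_mem a b h
    · exact ⟨x, by simpa using h.1, by simpa using h.2⟩
    · exact ⟨x, by simpa using h.2, by simpa using h.1⟩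
  · intro k hk z
    rw [Finset.card_subtype]
    exact (Finset.card_filter_le _ _).trans (hk z)

/-- A leaf whose bag is contained in the bag of its neighbour can be deleted. -/
theorem TreeDecomposition.exists_deleteLeaf {V : Type u} {G : SimpleGraph V}
    (D : G.TreeDecomposition) {x y : D.node} (hxy : D.tree.Adj x y)
    (hleaf : ∀ z, D.tree.Adj x z → z = y) (hbag : D.bag x ⊆ D.bag y) :
    ∃ D' : G.TreeDecomposition, Nat.card D'.node < Nat.card D.node ∧
      ∀ k, (∀ z, (D.bag z).card ≤ k) → ∀ z, (D'.bag z).card ≤ k := by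
  classical
  have htree := D.isTree.induce_compl_leaf hxy hleaf
  have := Fintype.ofFinite ({x}ᶜ : Set D.node)
  refine ⟨⟨({x}ᶜ : Set D.node), D.tree.induce {x}ᶜ, htree, fun z => D.bag z, fun v => ?_,
    fun v w h => ?_⟩, ?_, ?_⟩
  · exact ⟨connected_induce_induce_compl_leaf hxy hleaf (D.subtree v).connected
      fun h => hbag h, htree.isAcyclic.induce _⟩
  · obtain ⟨z, hv, hw⟩ := D.edge_mem v w h
    by_cases hz : z = x
    · subst hz
      exact ⟨⟨y, hxy.ne'⟩, hbag hv, hbag hw⟩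
    · exact ⟨⟨z, hz⟩, hv, hw⟩
  · exact Finite.card_subtype_lt (x := x) (by simp)
  · exact fun k hk z => hk z

/-- If a leaf bag contains a vertex that is not in the neighbouring bag, then this vertex lies in
no further bag. -/
theorem TreeDecomposition.eq_leaf_of_mem_bag {V : Type u} {G : SimpleGraph V}
    (D : G.TreeDecomposition) {x y : D.node} (hleaf : ∀ z, D.tree.Adj x z → z = y) {v : V}
    (hx : v ∈ D.bag x) (hy : v ∉ D.bag y) {z : D.node} (hz : v ∈ D.bag z) : z = x := by
  obtain ⟨p⟩ := (D.subtree v).connected.preconnected ⟨x, hx⟩ ⟨z, hz⟩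
  cases p with
  | nil => rfl
  | @cons _ w _ h _ => exact absurd (hleaf w.1 h ▸ w.2) hy

/-- A graph on more than `k` vertices with a tree decomposition into bags of size at most `k + 1`
is a spanning subgraph of a `k`-tree. -/
theorem TreeDecomposition.exists_isKTree_ge {V : Type u} [Finite V] {G : SimpleGraph V}
    (D : G.TreeDecomposition) {k : ℕ} (hk : k + 1 ≤ Nat.card V)
    (hD : ∀ x, (D.bag x).card ≤ k + 1) : ∃ H : SimpleGraph V, G ≤ H ∧ H.IsKTree k := by
  classical
  -- Deleting a redundant leaf lowers the number of nodes, deleting a private vertex that of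
  -- vertices; the sum drops either way.
  induction hn : Nat.card V + Nat.card D.node using Nat.strong_induction_on generalizing V with
  | _ n ih =>
  subst hn
  rcases hk.eq_or_lt with hk | hk
  · exact isKTree_of_card_eq hk.symm G
  have := D.isTree.connected.nonempty
  rcases subsingleton_or_nontrivial D.node with hnode | hnode
  · have x : D.node := Classical.arbitrary _
    have := Fintype.ofFinite V
    have huniv : D.bag x = Finset.univ := by
      ext v
      obtain ⟨z, hz⟩ := (D.subtree v).connected.nonempty
      simpa [Subsingleton.elim x z] using hz
    have := hD x
    rw [huniv, Finset.card_univ, ← Nat.card_eq_fintype_card] at this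
    omega
  obtain ⟨x, hx⟩ := D.isTree.exists_vert_degree_one_of_nontrivial
  obtain ⟨y, hxy, hleaf⟩ := degree_eq_one_iff_existsUnique_adj.1 hx
  by_cases hbag : D.bag x ⊆ D.bag y
  · obtain ⟨D', hcard, hD'⟩ := D.exists_deleteLeaf hxy hleaf hbag
    exact ih _ (by omega) D' hk.le (hD' _ hD) rfl
  obtain ⟨v, hvx, hvy⟩ := Finset.not_subset.1 hbag
  have hvonly : ∀ z, v ∈ D.bag z → z = x := fun z => D.eq_leaf_of_mem_bag hleaf hvx hvy
  have hcardV : Nat.card ({v}ᶜ : Set V) + 1 = Nat.card V := by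
    rw [Nat.card_coe_set_eq, ← Set.ncard_singleton v, add_comm]
    exact Set.ncard_add_ncard_compl _
  obtain ⟨D', hcard, hD'⟩ := D.exists_deleteVertex v x
  obtain ⟨H, hGH, hH⟩ := ih _ (by omega) D' (by omega) (hD' _ hD) rfl
  set s : Set ({v}ᶜ : Set V) := Subtype.val ⁻¹' (D.bag x : Set V) with hs
  have hsclique : H.IsClique s := fun a ha b hb hab => hGH (.inr ⟨hab, .inl ⟨ha, hb⟩⟩)
  have hscard : s.encard ≤ k := by
    have himage : Subtype.val '' s ⊆ ((D.bag x).erase v : Finset V) := by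
      rintro _ ⟨a, ha, rfl⟩
      exact Finset.mem_coe.2 (Finset.mem_erase.2 ⟨a.2, ha⟩)
    have h := Set.encard_le_encard himage
    rw [Subtype.val_injective.encard_image, Set.encard_coe_eq_coe_finsetCard,
      Finset.card_erase_of_mem hvx] at h
    refine h.trans ?_
    have := hD x
    exact_mod_cast (by omega : (D.bag x).card - 1 ≤ k)
  obtain ⟨t, hst, ht, htcard⟩ := hH.exists_isClique_superset hsclique
  -- Since `s` has at most `k` elements and `t` has `k + 1`, some `r` in between has exactly `k`,
  -- the degree that `v` needs.
  obtain ⟨r, hsr, hrt, hrcard⟩ := Set.exists_superset_subset_encard_eq hst hscard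
    (htcard ▸ le_self_add)
  refine ⟨addVertexAdj H r, ?_, hH.addVertexAdj (ht.subset hrt) hrcard⟩
  have hself : ∀ a : ({v}ᶜ : Set V), G.Adj v a → (addVertexAdj H r).Adj v a := by
    intro a ha
    obtain ⟨z, hz, haz⟩ := D.edge_mem _ _ ha
    obtain rfl := hvonly z hz
    exact (addVertexAdj_adj_self H r a).2 (hsr haz)
  intro a b hab
  by_cases ha : a = v
  · subst ha
    exact hself ⟨b, hab.ne'⟩ hab
  · by_cases hb : b = v
    · subst hb
      exact (hself ⟨a, ha⟩ hab.symm).symm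
    · exact (addVertexAdj_adj_coe H r ⟨a, ha⟩ ⟨b, hb⟩).2 (hGH (.inl hab))

/-- The treewidth of a nonempty graph is less than the number of its vertices. -/
theorem treewidth_add_one_le_card {V : Type u} [Finite V] [Nonempty V] (G : SimpleGraph V) :
    G.treewidth + 1 ≤ Nat.card V := by
  have := Fintype.ofFinite V
  obtain ⟨D⟩ := G.nonempty_treeDecomposition
  have h : D.width ≤ Nat.card V - 1 := by
    rw [Nat.card_eq_fintype_card]
    exact Nat.sub_le_sub_right (Finset.sup_le fun x _ => Finset.card_le_univ _) 1
  have : G.treewidth ≤ D.width := G.isLeast_treewidth.2 ⟨D, rfl⟩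
  have : 0 < Nat.card V := Nat.card_pos
  omega

theorem exists_isKTree_treewidth {V : Type u} [Finite V] [Nonempty V] (G : SimpleGraph V) :
    ∃ H : SimpleGraph V, G ≤ H ∧ H.IsKTree G.treewidth := by
  obtain ⟨D, hD⟩ := G.isLeast_treewidth.1
  refine D.exists_isKTree_ge G.treewidth_add_one_le_card fun x => ?_
  have hx : (D.bag x).card ≤ Finset.univ.sup fun x => (D.bag x).card :=
    Finset.le_sup (f := fun x => (D.bag x).card) (Finset.mem_univ x)
  have hD' : (Finset.univ.sup fun x => (D.bag x).card) - 1 = G.treewidth := hD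
  omega

end SimpleGraph

theorem mainTheorem12 {V : Type u} [Finite V] [Nonempty V] (G : SimpleGraph V) :
    IsLeast {k : ℕ | ∃ H : SimpleGraph V, G ≤ H ∧ H.IsKTree k} G.treewidth ∧
      IsLeast {k : ℕ | ∃ H : SimpleGraph V, G ≤ H ∧ H.IsChordal ∧ H.CliqueFree (k + 2)}
        G.treewidth := by
  obtain ⟨H, hGH, hH⟩ := G.exists_isKTree_treewidth
  refine ⟨⟨⟨H, hGH, hH⟩, ?_⟩, ⟨⟨H, hGH, hH.isChordal, hH.cliqueFree⟩, ?_⟩⟩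
  · rintro k ⟨H, hGH, hH⟩
    exact hH.isChordal.treewidth_le hGH hH.cliqueFree
  · rintro k ⟨H, hGH, hH, hfree⟩
    exact hH.treewidth_le hGH hfree
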